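/- Let $K$ be a field, let $N\subseteq K^\times$ be a subgroup of finite index containing $-1$, and let $\Gamma$ be a totally ordered group, written additively but not necessarily commutative. For a homomorphism $\varphi\colon N\to\Gamma$ and $\alpha\in\Gamma$ write $N_{>\alpha}=\{x\in N:\varphi(x)>\alpha\}$, and similarly $N_{\ge\alpha}$, $N_{\le\alpha}$. Let $\varphi\colon N\to\Gamma$ be a *strong valuation-like map*, i.e. a homomorphism for which there is $\alpha\in\Gamma$, $\alpha\ge 0$, such that $N_{>\alpha}\neq\emptyset$ and $$1\pm N_{>\alpha}\subseteq N_{\le 0}.$$ A *valuation* on $K$ is a surjective homomorphism $v\colon K^\times\to\Gamma_v$ onto a totally ordered group with $v(x+y)\ge\min(v(x),v(y))$ whenever $x+y\ne0$; its height is the height of $\Gamma_v$, i.e. the supremum of the lengths $r$ of chains $\Gamma_v=\Gamma_0\to\Gamma_1\to\cdots\to\Gamma_r=\{0\}$ of epimorphisms of totally ordered groups with non-trivial kernels. The valuation $v$ is *associated with* $\varphi$ if $\varphi(n)\ge0$ implies $v(n)\ge 0$ for all $n\in N$. Then there exists a non-trivial valuation $v$ on $K$ such that 1. $v$ is associated with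 $\varphi$, and $N$ is open in $K^\times$ in the $v$-adic topology; 2. if, additionally, $K$ has finite transcendence degree over its prime field, then $v$ has height one; 3. the subring $\mathcal R$ of $K$ generated by $N_{\ge0}$ is open in the $v$-adic topology on $K$. -/

import Mathlib

open Topology

universe u v

section LeveledMaps

variable {D : Type u} [DivisionRing D] {N : Subgroup Dˣ} {Γ : Type v} [AddGroup Γ]

/-- `α` is an s-level of the homomorphism `φ : N → Γ` to a partially ordered (additively written,
not necessarily commutative) group: `α ≥ 0`, the set `N_{>α}` is non-empty, and
`1 ± N_{>α} ⊆ N_{≤0}`. The inclusion says in particular that `1 ± x` is non-zero and lies in `N`. -/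
def IsSLevel [PartialOrder Γ] (φ : Additive N →+ Γ) (α : Γ) : Prop :=
  0 ≤ α ∧
  (∃ x : N, α < φ (.ofMul x)) ∧
  ∀ x : N, α < φ (.ofMul x) →
    (∃ y : N, ((y : Dˣ) : D) = 1 + ((x : Dˣ) : D) ∧ φ (.ofMul y) ≤ 0) ∧
    (∃ y : N, ((y : Dˣ) : D) = 1 - ((x : Dˣ) : D) ∧ φ (.ofMul y) ≤ 0)

/-- A strongly leveled map: a homomorphism to a partially ordered group that has an s-level. -/
def IsStronglyLeveled [PartialOrder Γ] (φ : Additive N →+ Γ) : Prop :=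
  ∃ α : Γ, IsSLevel φ α

/-- A strong valuation-like map: a strongly leveled map to a totally ordered group. -/
def IsStrongValuationLike [LinearOrder Γ] (φ : Additive N →+ Γ) : Prop :=
  IsStronglyLeveled φ

/-- The subring generated by `N_{≥0}`. -/
def nonnegSubring [PartialOrder Γ] (φ : Additive N →+ Γ) : Subring D :=
  Subring.closure {d : D | ∃ x : N, 0 ≤ φ (.ofMul x) ∧ ((x : Dˣ) : D) = d}

/-- The valuation `w` is associated with `φ`: if `φ(n) ≥ 0` then `w(n) ≥ 0`. Mathlib writes the
value group multiplicatively and with the reversed order, so the latter condition is `w n ≤ 1`. -/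
def IsAssociated [PartialOrder Γ] (φ : Additive N →+ Γ)
    {Γ₀ : Type*} [LinearOrderedCommGroupWithZero Γ₀] (w : Valuation D Γ₀) : Prop :=
  ∀ x : N, 0 ≤ φ (.ofMul x) → w ((x : Dˣ) : D) ≤ 1

end LeveledMaps

section AdicTopology

variable {K : Type u} [Field K] {Γ₀ : Type v} [LinearOrderedCommGroupWithZero Γ₀]

/-- The `w`-adic topology on `K`, for which the sets `{x | w x < γ}`, with `γ` in the value group,
form a fundamental system of neighbourhoods of zero. -/
@[reducible]
noncomputable def adicTopology (w : Valuation K Γ₀) : TopologicalSpace K :=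
  (Valued.mk' w).toUniformSpace.toTopologicalSpace

/-- The `w`-adic topology on the multiplicative group, induced from that of `K`. -/
@[reducible]
noncomputable def adicTopologyUnits (w : Valuation K Γ₀) : TopologicalSpace Kˣ :=
  (adicTopology w).induced (fun x : Kˣ => (x : K))

end AdicTopology

section Height

/-- There is a chain `Γ = Γ_0 → Γ_1 → ⋯ → Γ_r = 1` of `r` epimorphisms of totally ordered
commutative groups, each with non-trivial kernel. -/
def HasEpiChain : ℕ → ∀ (Γ : Type u) [CommGroup Γ] [LinearOrder Γ] [IsOrderedMonoid Γ], Prop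
  | 0, Γ, _, _, _ => Subsingleton Γ
  | r + 1, Γ, _, _, _ =>
    ∃ (Γ' : Type u) (_ : CommGroup Γ') (_ : LinearOrder Γ') (_ : IsOrderedMonoid Γ')
      (μ : Γ →* Γ'), Monotone μ ∧ Function.Surjective μ ∧ μ.ker ≠ ⊥ ∧ HasEpiChain r Γ'

/-- The height of a totally ordered commutative group: the supremum of the lengths of the chains
above. -/
noncomputable def groupHeight (Γ : Type u) [CommGroup Γ] [LinearOrder Γ] [IsOrderedMonoid Γ] : ℕ∞ :=
  ⨆ (r : ℕ) (_ : HasEpiChain r Γ), (r : ℕ∞)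

end Height

/-! Let `R` be the subring generated by `N_{≥0}`. Each element of `N` or its inverse lies in `R`,
and each unit of `K` has a power in `N`, so the integral closure of `R` is a valuation ring. It is
proper: otherwise `R` is a field and contains `t⁻¹` for some `t` above the level `α`, whereas `1 +
tR ⊆ N` (`exists_one_add_mul`) excludes `1 - t * t⁻¹ = 0`.

Every valuation ring containing `R` gives an associated valuation. As `K = Frac R` and `N` has
finite index, `R` contains a ball (`exists_ball_subset`), so `R` is open, and so is `N`, because
`n(1 + tR) ⊆ N`.

In finite transcendence degree some `y` has powers of arbitrarily small value
(`exists_cofinal_powers`): otherwise successive infinitely smaller elements would be algebraically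
independent. Coarsening along `y` leaves a proper overring of height one. -/

/-! ### Strong levels and the ring generated by `N_{≥0}` -/

section LevelSet

set_option linter.unusedSectionVars false

variable {K : Type u} [Field K] {N : Subgroup Kˣ}
  {Γ : Type v} [AddGroup Γ] [LinearOrder Γ] [AddLeftMono Γ] [AddRightMono Γ]
  {φ : Additive N →+ Γ} {α : Γ}

/-- The additive subgroup generated by `N_{>α}`. -/
def aboveAddSubgroup (φ : Additive N →+ Γ) (α : Γ) : AddSubgroup K :=
  AddSubgroup.closure {d : K | ∃ x : N, α < φ (.ofMul x) ∧ ((x : Kˣ) : K) = d}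

lemma map_ofMul_mul (φ : Additive N →+ Γ) (x y : N) :
    φ (.ofMul (x * y)) = φ (.ofMul x) + φ (.ofMul y) := by
  rw [ofMul_mul, map_add]

lemma map_ofMul_inv (φ : Additive N →+ Γ) (x : N) :
    φ (.ofMul x⁻¹) = -φ (.ofMul x) := by
  rw [ofMul_inv, map_neg]

lemma map_neg_one_eq_zero (hN : (-1 : Kˣ) ∈ N) (φ : Additive N →+ Γ) :
    φ (.ofMul ⟨-1, hN⟩) = 0 := by
  have h : φ (.ofMul (⟨-1, hN⟩ * ⟨-1, hN⟩ : N)) = 0 := by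
    have : (⟨-1, hN⟩ * ⟨-1, hN⟩ : N) = 1 := by ext; simp
    rw [this, ofMul_one, map_zero]
  rw [map_ofMul_mul] at h
  rcases lt_trichotomy (φ (.ofMul ⟨-1, hN⟩)) 0 with h1 | h1 | h1
  · exact absurd h (add_neg h1 h1).ne
  · exact h1
  · exact absurd h (add_pos h1 h1).ne'

/-- With `x` also `x / (1 + x)` lies above `α`, and `1 - x / (1 + x)` is the inverse of `1 + x`. -/
lemma IsSLevel.map_one_add_eq_zero (h : IsSLevel φ α) {x y : N} (hx : α < φ (.ofMul x))
    (hy : ((y : Kˣ) : K) = 1 + ((x : Kˣ) : K)) : φ (.ofMul y) = 0 := by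
  obtain ⟨⟨z, hz, hz0⟩, -⟩ := h.2.2 x hx
  obtain rfl : z = y := by ext; rw [hz, hy]
  refine le_antisymm hz0 ?_
  have hxy : α < φ (.ofMul (x * z⁻¹)) := by
    rw [map_ofMul_mul, map_ofMul_inv]
    exact lt_of_lt_of_le hx (le_add_of_nonneg_right (neg_nonneg.2 hz0))
  obtain ⟨-, ⟨u, hu, hu0⟩⟩ := h.2.2 _ hxy
  have : u = z⁻¹ := by
    ext
    have hne : ((z : Kˣ) : K) ≠ 0 := (z : Kˣ).ne_zero
    rw [hu]
    push_cast
    field_simp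
    rw [hz]; ring
  rw [this, map_ofMul_inv] at hu0
  exact neg_nonpos.1 hu0

/-- Since `n + x = n(1 + n⁻¹x)`, adding one generator stays inside the kernel of `φ`; the generators
of `s` are added one at a time. -/
lemma IsSLevel.exists_add_of_mem_above (hN : (-1 : Kˣ) ∈ N) (h : IsSLevel φ α) {s : K}
    (hs : s ∈ aboveAddSubgroup φ α) :
    ∀ n : N, φ (.ofMul n) = 0 →
      ∃ y : N, ((y : Kˣ) : K) = ((n : Kˣ) : K) + s ∧ φ (.ofMul y) = 0 := by
  induction hs using AddSubgroup.closure_induction with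
  | mem x hx =>
    obtain ⟨x, hx, rfl⟩ := hx
    intro n hn
    have hxn : α < φ (.ofMul (n⁻¹ * x)) := by
      rwa [map_ofMul_mul, map_ofMul_inv, hn, neg_zero, zero_add]
    obtain ⟨⟨z, hz, -⟩, -⟩ := h.2.2 _ hxn
    refine ⟨n * z, ?_, ?_⟩
    · have hne : ((n : Kˣ) : K) ≠ 0 := (n : Kˣ).ne_zero
      push_cast
      rw [hz]
      push_cast
      field_simp
    · rw [map_ofMul_mul, hn, h.map_one_add_eq_zero hxn hz, add_zero]
  | zero => exact fun n hn => ⟨n, by simp, hn⟩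
  | add x y _ _ hx hy =>
    intro n hn
    obtain ⟨m, hm, hm0⟩ := hx n hn
    obtain ⟨l, hl, hl0⟩ := hy m hm0
    exact ⟨l, by rw [hl, hm, add_assoc], hl0⟩
  | neg x _ hx =>
    intro n hn
    have hneg (m : N) (hm : φ (.ofMul m) = 0) : φ (.ofMul (⟨-1, hN⟩ * m)) = 0 := by
      rw [map_ofMul_mul, hm, map_neg_one_eq_zero, add_zero]
    obtain ⟨m, hm, hm0⟩ := hx (⟨-1, hN⟩ * n) (hneg n hn)
    refine ⟨⟨-1, hN⟩ * m, ?_, hneg m hm0⟩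
    push_cast at hm ⊢
    rw [hm]; ring

lemma mul_mem_above {s r : K} (hs : s ∈ aboveAddSubgroup φ α) (hr : r ∈ nonnegSubring φ) :
    s * r ∈ aboveAddSubgroup φ α := by
  induction hr using Subring.closure_induction generalizing s with
  | mem x hx =>
    obtain ⟨x, hx, rfl⟩ := hx
    induction hs using AddSubgroup.closure_induction with
    | mem y hy =>
      obtain ⟨y, hy, rfl⟩ := hy
      refine AddSubgroup.subset_closure ⟨y * x, ?_, by push_cast; rfl⟩
      rw [map_ofMul_mul]
      exact lt_of_lt_of_le hy (le_add_of_nonneg_right hx)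
    | zero => simp [zero_mem]
    | add y z _ _ hy hz => rw [add_mul]; exact add_mem hy hz
    | neg y _ hy => rw [neg_mul]; exact neg_mem hy
  | zero => simp [zero_mem]
  | one => simpa using hs
  | add x y _ _ hx hy => rw [mul_add]; exact add_mem (hx hs) (hy hs)
  | neg x _ hx => rw [mul_neg]; exact neg_mem (hx hs)
  | mul x y _ _ hx hy => rw [← mul_assoc]; exact hy (hx hs)

lemma coe_mem_nonnegSubring {x : N} (hx : 0 ≤ φ (.ofMul x)) :
    ((x : Kˣ) : K) ∈ nonnegSubring φ :=
  Subring.subset_closure ⟨x, hx, rfl⟩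

lemma coe_mem_above {x : N} (hx : α < φ (.ofMul x)) :
    ((x : Kˣ) : K) ∈ aboveAddSubgroup φ α :=
  AddSubgroup.subset_closure ⟨x, hx, rfl⟩

lemma IsSLevel.exists_one_add_mul (hN : (-1 : Kˣ) ∈ N) (h : IsSLevel φ α) {t : N}
    (ht : α < φ (.ofMul t)) {r : K} (hr : r ∈ nonnegSubring φ) :
    ∃ y : N, ((y : Kˣ) : K) = 1 + ((t : Kˣ) : K) * r := by
  obtain ⟨y, hy, -⟩ := h.exists_add_of_mem_above hN (mul_mem_above (coe_mem_above ht) hr) 1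
    (by rw [ofMul_one, map_zero])
  exact ⟨y, by simpa using hy⟩

lemma IsSLevel.inv_notMem_nonnegSubring (hN : (-1 : Kˣ) ∈ N) (h : IsSLevel φ α) {t : N}
    (ht : α < φ (.ofMul t)) : ((t : Kˣ) : K)⁻¹ ∉ nonnegSubring φ := by
  intro hmem
  obtain ⟨y, hy⟩ := h.exists_one_add_mul hN ht (neg_mem hmem)
  have hne : ((t : Kˣ) : K) ≠ 0 := (t : Kˣ).ne_zero
  refine (y : Kˣ).ne_zero ?_
  rw [hy, mul_neg, mul_inv_cancel₀ hne, add_neg_cancel]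

/-- Elements of `N` are fractions of elements of `N_{≥0}`. -/
lemma coe_or_inv_mem_nonnegSubring (φ : Additive N →+ Γ) (x : N) :
    ((x : Kˣ) : K) ∈ nonnegSubring φ ∨ ((x : Kˣ) : K)⁻¹ ∈ nonnegSubring φ := by
  rcases le_total 0 (φ (.ofMul x)) with hx | hx
  · exact .inl (coe_mem_nonnegSubring hx)
  · right
    have : 0 ≤ φ (.ofMul x⁻¹) := by rw [map_ofMul_inv]; exact neg_nonneg.2 hx
    simpa using coe_mem_nonnegSubring this

lemma exists_pow_mem (N : Subgroup Kˣ) [N.FiniteIndex] {x : K} (hx : x ≠ 0) :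
    ∃ m : ℕ, 0 < m ∧ ∃ y : N, ((y : Kˣ) : K) = x ^ m := by
  refine ⟨N.index, Nat.pos_of_ne_zero N.index_ne_zero_of_finite,
    ⟨Units.mk0 x hx ^ N.index, N.pow_index_mem _⟩, by simp⟩

/-- The integral closure in `K` of the subring generated by `N_{≥0}` is a valuation ring. -/
noncomputable def integralValuationSubring [N.FiniteIndex] (φ : Additive N →+ Γ) :
    ValuationSubring K where
  __ := (integralClosure (nonnegSubring φ) K).toSubring
  mem_or_inv_mem' x := by
    change IsIntegral _ x ∨ IsIntegral _ x⁻¹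
    rcases eq_or_ne x 0 with rfl | hx
    · exact .inl isIntegral_zero
    -- A root of an element of `R` is integral over `R`.
    obtain ⟨m, hm, y, hy⟩ := exists_pow_mem N hx
    rcases coe_or_inv_mem_nonnegSubring φ y with h | h
    · rw [hy] at h
      exact .inl (IsIntegral.of_pow hm (isIntegral_algebraMap (x := (⟨_, h⟩ : nonnegSubring φ))))
    · rw [hy, ← inv_pow] at h
      exact .inr (IsIntegral.of_pow hm (isIntegral_algebraMap (x := (⟨_, h⟩ : nonnegSubring φ))))

lemma mem_integralValuationSubring [N.FiniteIndex] {x : K} :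
    x ∈ integralValuationSubring φ ↔ IsIntegral (nonnegSubring φ) x := Iff.rfl

lemma nonnegSubring_le_integralValuationSubring [N.FiniteIndex] {x : K}
    (hx : x ∈ nonnegSubring φ) : x ∈ integralValuationSubring φ :=
  isIntegral_algebraMap (x := (⟨_, hx⟩ : nonnegSubring φ))

/-- If the field `K` were integral over `R`, then `R` would be a field, against
`inv_notMem_nonnegSubring`. -/
lemma IsSLevel.exists_notMem_integralValuationSubring [N.FiniteIndex] (hN : (-1 : Kˣ) ∈ N)
    (h : IsSLevel φ α) : ∃ x : K, x ∉ integralValuationSubring φ := by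
  by_contra! hall
  have : Algebra.IsIntegral (nonnegSubring φ) K := ⟨hall⟩
  have hf : IsField (nonnegSubring φ) :=
    isField_of_isIntegral_of_isField (FaithfulSMul.algebraMap_injective _ K) (Field.toIsField K)
  obtain ⟨t, ht⟩ := h.2.1
  obtain ⟨s, hs⟩ := hf.mul_inv_cancel
    (a := ⟨_, coe_mem_nonnegSubring (h.1.trans ht.le)⟩) (by simp [Subtype.ext_iff])
  refine h.inv_notMem_nonnegSubring hN ht ?_
  have hs' : ((t : Kˣ) : K) * s = 1 := congrArg Subtype.val hs
  rw [← eq_inv_of_mul_eq_one_right hs']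
  exact s.2

lemma IsSLevel.infinite (h : IsSLevel φ α) : Infinite N := by
  obtain ⟨t, ht⟩ := h.2.1
  refine Infinite.of_injective (fun k : ℕ => t ^ k) ?_
  have hpos : 0 < φ (.ofMul t) := h.1.trans_lt ht
  have hm : StrictMono fun k : ℕ => φ (.ofMul (t ^ k)) := by
    refine strictMono_nat_of_lt_succ fun k => ?_
    rw [pow_succ, map_ofMul_mul]
    exact lt_add_of_pos_right _ hpos
  exact fun a b hab => hm.injective (congrArg (fun x => φ (.ofMul x)) hab)

lemma exists_mul_mem_of_div {R : Subring K} {a b c : K} (ha : ∃ d : K, d ≠ 0 ∧ d ∈ R ∧ d * a ∈ R)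
    (hb : ∃ d : K, d ≠ 0 ∧ d ∈ R ∧ d * b ∈ R) (hb0 : b ≠ 0) (hc : c * b = a) :
    ∃ d : K, d ≠ 0 ∧ d ∈ R ∧ d * c ∈ R := by
  obtain ⟨d, hd, hdR, hda⟩ := ha
  obtain ⟨e, he, heR, heb⟩ := hb
  refine ⟨d * (e * b), mul_ne_zero hd (mul_ne_zero he hb0), mul_mem hdR heb, ?_⟩
  have : d * (e * b) * c = e * (d * a) := by rw [← hc]; ring
  rw [this]
  exact mul_mem heR hda

/-- `K` is the field of fractions of the subring generated by `N_{≥0}`. -/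
lemma IsSLevel.exists_mul_mem_nonnegSubring [N.FiniteIndex] (h : IsSLevel φ α) (c : K) :
    ∃ d : K, d ≠ 0 ∧ d ∈ nonnegSubring φ ∧ d * c ∈ nonnegSubring φ := by
  have hfrac (x : N) : ∃ d : K, d ≠ 0 ∧ d ∈ nonnegSubring φ ∧
      d * ((x : Kˣ) : K) ∈ nonnegSubring φ := by
    have hne : ((x : Kˣ) : K) ≠ 0 := (x : Kˣ).ne_zero
    rcases coe_or_inv_mem_nonnegSubring φ x with hx | hx
    · exact ⟨1, one_ne_zero, one_mem _, by simpa using hx⟩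
    · exact ⟨_, inv_ne_zero hne, hx, by rw [inv_mul_cancel₀ hne]; exact one_mem _⟩
  have hmul {a b : K} (ha : ∃ d : K, d ≠ 0 ∧ d ∈ nonnegSubring φ ∧ d * a ∈ nonnegSubring φ)
      (hb : ∃ d : K, d ≠ 0 ∧ d ∈ nonnegSubring φ ∧ d * b ∈ nonnegSubring φ) :
      ∃ d : K, d ≠ 0 ∧ d ∈ nonnegSubring φ ∧ d * (a - b) ∈ nonnegSubring φ := by
    obtain ⟨d, hd, hdR, hda⟩ := ha
    obtain ⟨e, he, heR, heb⟩ := hb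
    refine ⟨d * e, mul_ne_zero hd he, mul_mem hdR heR, ?_⟩
    have : d * e * (a - b) = e * (d * a) - d * (e * b) := by ring
    rw [this]
    exact sub_mem (mul_mem heR hda) (mul_mem hdR heb)
  have := h.infinite
  -- At most one element of `N` is excluded, namely `-c`.
  let S : Set N := {x : N | c + ((x : Kˣ) : K) ≠ 0}
  have hS : S.Infinite := by
    have : Sᶜ.Finite := by
      refine Set.Subsingleton.finite fun x hx y hy => ?_
      simp only [S, Set.mem_compl_iff, Set.mem_ofPred_eq, not_not] at hx hy
      ext
      exact add_left_cancel (hx.trans hy.symm)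
    exact fun hfin => Set.infinite_univ (S.union_compl_self ▸ hfin.union this)
  have : Infinite S := hS.to_subtype
  -- By pigeonhole `c + s' = n(c + s)` with `n ∈ N`, `n ≠ 1`; hence `c = (s' - ns) / (n - 1)`.
  obtain ⟨s, s', hne, hss⟩ := Finite.exists_ne_map_eq_of_infinite
    (fun s : S => (QuotientGroup.mk (Units.mk0 _ s.2) : Kˣ ⧸ N))
  rw [QuotientGroup.eq] at hss
  set n : N := ⟨_, hss⟩ with hn
  have hs0 : c + ((s.1 : Kˣ) : K) ≠ 0 := s.2
  have key : ((n : Kˣ) : K) * (c + ((s.1 : Kˣ) : K)) = c + ((s'.1 : Kˣ) : K) := by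
    rw [hn]
    push_cast
    simp only [Units.val_mk0]
    field_simp
  have hn1 : ((n : Kˣ) : K) ≠ 1 := by
    intro h1
    rw [h1, one_mul] at key
    exact hne (Subtype.ext (Subtype.ext (Units.ext (add_left_cancel key))))
  refine exists_mul_mem_of_div (a := ((s'.1 : Kˣ) : K) - ((n * s.1 : N) : Kˣ))
    (b := ((n : Kˣ) : K) - ((1 : N) : Kˣ)) (hmul (hfrac _) (hfrac _)) (hmul (hfrac _) (hfrac _))
    (by simpa [sub_eq_zero] using hn1) ?_
  push_cast
  linear_combination key

end LevelSet

/-! ### Openness in the adic topology -/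

section AdicOpen

variable {K : Type u} [Field K] {Γ₀ : Type*} [LinearOrderedCommGroupWithZero Γ₀]

lemma isOpen_adicTopology {w : Valuation K Γ₀} {U : Set K}
    (h : ∀ x ∈ U, ∃ c : K, c ≠ 0 ∧ ∀ y, w (y - x) < w c → y ∈ U) :
    IsOpen[adicTopology w] U := by
  let : Valued K Γ₀ := Valued.mk' w
  change IsOpen U
  rw [isOpen_iff_mem_nhds]
  intro x hx
  obtain ⟨c, hc, hcU⟩ := h x hx
  rw [Valued.mem_nhds]
  have hc' : w.restrict c ≠ 0 := by simpa using hc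
  exact ⟨Units.mk0 _ hc', fun y hy => hcU y (w.restrict_lt_iff.mp hy)⟩

variable {N : Subgroup Kˣ} {Γ : Type v} [AddGroup Γ] [LinearOrder Γ] [AddLeftMono Γ]
  [AddRightMono Γ] {φ : Additive N →+ Γ} {α : Γ} {w : Valuation K Γ₀}

/-- The subring generated by `N_{≥0}` contains a ball for every valuation associated
with `φ`. -/
lemma IsAssociated.exists_ball_subset [N.FiniteIndex] (hw : IsAssociated φ w)
    (h : IsSLevel φ α) :
    ∃ c : K, c ≠ 0 ∧ ∀ z, w z < w c → z ∈ nonnegSubring φ := by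
  classical
  have := Fintype.ofFinite (Kˣ ⧸ N)
  let c (q : Kˣ ⧸ N) : K := (Quotient.out q : Kˣ)
  have hc (q) : c q ≠ 0 := (Quotient.out q : Kˣ).ne_zero
  choose d hd hdR hdc using fun q => h.exists_mul_mem_nonnegSubring (c q)
  -- A power of the product of all denominators is a common denominator of the coset representatives
  -- that lies in `N`.
  obtain ⟨m, hm, b, hb⟩ := exists_pow_mem N (x := ∏ q, d q) (Finset.prod_ne_zero_iff.2 fun q _ => hd q)
  have hbc (q) : ((b : Kˣ) : K) * c q ∈ nonnegSubring φ := by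
    obtain ⟨k, rfl⟩ := Nat.exists_eq_add_of_lt hm
    rw [hb, zero_add, pow_succ, mul_assoc]
    refine mul_mem (pow_mem (prod_mem fun q _ => hdR q) _) ?_
    rw [← Finset.prod_erase_mul _ _ (Finset.mem_univ q), mul_assoc]
    exact mul_mem (prod_mem fun q _ => hdR q) (hdc q)
  have hb0 : ((b : Kˣ) : K) ≠ 0 := (b : Kˣ).ne_zero
  -- Minimality of `w (c q₀)` makes one radius serve all cosets: for `z = n * c q` in the ball, `w n
  -- < w b`.
  obtain ⟨q₀, hq₀⟩ := Finite.exists_min fun q => w (c q)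
  refine ⟨((b : Kˣ) : K) * c q₀, mul_ne_zero hb0 (hc q₀), fun z hz => ?_⟩
  rcases eq_or_ne z 0 with rfl | hz0
  · exact zero_mem _
  set q : Kˣ ⧸ N := QuotientGroup.mk (Units.mk0 z hz0) with hq
  have hmem : (Quotient.out q)⁻¹ * Units.mk0 z hz0 ∈ N := by
    rw [← QuotientGroup.eq, ← hq]
    exact Quotient.out_eq q
  set n : N := ⟨_, hmem⟩ with hn
  have hnz : ((n : Kˣ) : K) * c q = z := by
    rw [hn]
    simp only [Units.val_mul, Units.val_inv_eq_inv_val, Units.val_mk0]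
    change (c q)⁻¹ * z * c q = z
    have := hc q
    field_simp
  have hlt : w ((n : Kˣ) : K) < w ((b : Kˣ) : K) := by
    have h1 : w ((n : Kˣ) : K) * w (c q) < w ((b : Kˣ) : K) * w (c q) := by
      rw [← map_mul, hnz]
      refine hz.trans_le ?_
      rw [map_mul]
      exact mul_le_mul_right (hq₀ q) _
    exact lt_of_mul_lt_mul_right h1 zero_le
  -- Otherwise `φ (b / n) ≥ 0`, and association would give `w b ≤ w n`.
  have hnb : 0 ≤ φ (.ofMul (n * b⁻¹)) := by
    by_contra! hneg
    have h2 : 0 ≤ φ (.ofMul (n * b⁻¹)⁻¹) := by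
      rw [map_ofMul_inv]; exact neg_nonneg.2 hneg.le
    have h3 := hw _ h2
    have hn0 : 0 < w ((n : Kˣ) : K) := by simp [zero_lt_iff]
    rw [mul_inv_rev, inv_inv] at h3
    push_cast at h3
    rw [map_mul, map_inv₀, mul_inv_le_iff₀ hn0, one_mul] at h3
    exact (h3.trans_lt hlt).false
  have : z = ((n * b⁻¹ : N) : Kˣ) * (((b : Kˣ) : K) * c q) := by
    rw [← hnz]; push_cast; field_simp
  rw [this]
  exact mul_mem (coe_mem_nonnegSubring hnb) (hbc q)

lemma IsAssociated.isOpen_nonnegSubring [N.FiniteIndex] (hw : IsAssociated φ w)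
    (h : IsSLevel φ α) : IsOpen[adicTopology w] (nonnegSubring φ : Set K) := by
  obtain ⟨c, hc, hcR⟩ := hw.exists_ball_subset h
  refine isOpen_adicTopology fun x hx => ⟨c, hc, fun y hy => ?_⟩
  simpa using add_mem (hcR _ hy) hx

/-- If `y` is close to `n ∈ N`, then `y = n(1 + tr)` with `r ∈ R`, and `1 + tR ⊆ N`. -/
lemma IsAssociated.isOpen_subgroup [N.FiniteIndex] (hw : IsAssociated φ w)
    (hN : (-1 : Kˣ) ∈ N) (h : IsSLevel φ α) : IsOpen[adicTopologyUnits w] (N : Set Kˣ) := by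
  obtain ⟨c, hc, hcR⟩ := hw.exists_ball_subset h
  obtain ⟨t, ht⟩ := h.2.1
  have ht0 : ((t : Kˣ) : K) ≠ 0 := (t : Kˣ).ne_zero
  refine ⟨{x : K | ∃ n : N, ((n : Kˣ) : K) = x}, isOpen_adicTopology ?_, ?_⟩
  · rintro _ ⟨n, rfl⟩
    have hn0 : ((n : Kˣ) : K) ≠ 0 := (n : Kˣ).ne_zero
    refine ⟨((n : Kˣ) : K) * ((t : Kˣ) : K) * c, mul_ne_zero (mul_ne_zero hn0 ht0) hc, fun y hy => ?_⟩
    have hr : (((n : Kˣ) : K) * ((t : Kˣ) : K))⁻¹ * (y - ((n : Kˣ) : K)) ∈ nonnegSubring φ := by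
      refine hcR _ ?_
      rw [map_mul _ (_ * _) c] at hy
      rw [map_mul, map_inv₀]
      exact (inv_mul_lt_iff₀ (by simp [zero_lt_iff, hn0, ht0])).2 hy
    obtain ⟨u, hu⟩ := h.exists_one_add_mul hN ht hr
    refine ⟨n * u, ?_⟩
    push_cast
    rw [hu]
    field_simp
    ring
  · ext x
    exact ⟨fun ⟨n, hn⟩ => Units.ext hn ▸ n.2, fun hx => ⟨⟨x, hx⟩, rfl⟩⟩

end AdicOpen

/-! ### A criterion for height one -/

section Height

lemma HasEpiChain.eq_zero_of_subsingleton {r : ℕ} {Γ : Type u} [CommGroup Γ] [LinearOrder Γ]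
    [IsOrderedMonoid Γ] [Subsingleton Γ] (h : HasEpiChain r Γ) : r = 0 := by
  cases r with
  | zero => rfl
  | succ r =>
    obtain ⟨Γ', _, _, _, μ, -, -, hker, -⟩ := h
    exact absurd (Subsingleton.elim _ _) hker

/-- If every element below one has powers below any given element, the height is one. -/
lemma groupHeight_eq_one {Γ : Type u} [CommGroup Γ] [LinearOrder Γ] [IsOrderedMonoid Γ]
    [Nontrivial Γ] (h : ∀ g : Γ, g < 1 → ∀ f : Γ, ∃ k : ℕ, g ^ k ≤ f) : groupHeight Γ = 1 := by
  refine le_antisymm (iSup₂_le fun r hr => ?_) ?_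
  · cases r with
    | zero => simp
    | succ r =>
      obtain ⟨Γ', _, _, _, μ, hmono, hsurj, hker, hr⟩ := hr
      -- The powers of a kernel element below one get below every `f`, so the monotone `μ` is
      -- trivial.
      obtain ⟨g, hg, hg1⟩ : ∃ g, μ g = 1 ∧ g < 1 := by
        obtain ⟨⟨g, hg⟩, hne'⟩ := Subgroup.ne_bot_iff_exists_ne_one.1 hker
        have hne : g ≠ 1 := fun h1 => hne' (Subtype.ext h1)
        rw [MonoidHom.mem_ker] at hg
        rcases lt_or_gt_of_ne hne with hlt | hlt
        · exact ⟨g, hg, hlt⟩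
        · exact ⟨g⁻¹, by simp [hg], by simpa using hlt⟩
      have hle (f : Γ) : 1 ≤ μ f := by
        obtain ⟨k, hk⟩ := h g hg1 f
        simpa [hg] using hmono hk
      have htriv (f : Γ) : μ f = 1 :=
        le_antisymm (by simpa using hle f⁻¹) (hle f)
      have : Subsingleton Γ' := ⟨fun a b => by
        obtain ⟨a, rfl⟩ := hsurj a
        obtain ⟨b, rfl⟩ := hsurj b
        rw [htriv, htriv]⟩
      simp [hr.eq_zero_of_subsingleton]
  · refine le_iSup₂_of_le 1 ⟨PUnit, inferInstance, inferInstance,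
      { mul_le_mul_left := fun _ _ _ _ => le_rfl }, 1,
      fun _ _ _ => le_rfl, fun _ => ⟨1, rfl⟩, ?_, ?_⟩ (by simp)
    · simp
    · exact inferInstanceAs (Subsingleton PUnit)

end Height

/-! ### Coarsening to a valuation ring of height one -/

section Coarsening

variable {K : Type u} [Field K]

/-- The valuation ring of all `x` whose powers have values at most that of `y⁻¹`. -/
def ValuationSubring.coarsening (A : ValuationSubring K) (y : K) (hy : A.valuation y ≤ 1) :
    ValuationSubring K where
  carrier := {x | ∀ k : ℕ, A.valuation x ^ k * A.valuation y ≤ 1}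
  zero_mem' k := by
    rcases k.eq_zero_or_pos with rfl | hk
    · simpa using hy
    · simp [hk.ne']
  one_mem' k := by simpa using hy
  neg_mem' h k := by rw [Valuation.map_neg]; exact h k
  add_mem' {a b} ha hb k := by
    rcases le_max_iff.1 (A.valuation.map_add a b) with h | h
    · exact (mul_le_mul_left (pow_le_pow_left' h k) _).trans (ha k)
    · exact (mul_le_mul_left (pow_le_pow_left' h k) _).trans (hb k)
  mul_mem' {a b} ha hb k := by
    rw [map_mul]
    -- The product is at most the square of the larger factor, whose condition is used with exponent
    -- `2 * k`.
    rcases le_total (A.valuation a) (A.valuation b) with h | h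
    · refine (mul_le_mul_left (pow_le_pow_left' (mul_le_mul_left h _) k) _).trans ?_
      rw [← pow_two, ← pow_mul]
      exact hb _
    · refine (mul_le_mul_left (pow_le_pow_left' (mul_le_mul_right h _) k) _).trans ?_
      rw [← pow_two, ← pow_mul]
      exact ha _
  mem_or_inv_mem' x := by
    have hmem {z : K} (hz : z ∈ A) (k : ℕ) : A.valuation z ^ k * A.valuation y ≤ 1 :=
      mul_le_one' (pow_le_one' ((A.valuation_le_one_iff z).2 hz) k) hy
    exact (A.mem_or_inv_mem x).imp hmem hmem

variable {A : ValuationSubring K} {y : K}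

lemma ValuationSubring.mem_coarsening {hy : A.valuation y ≤ 1} {x : K} :
    x ∈ A.coarsening y hy ↔ ∀ k : ℕ, A.valuation x ^ k * A.valuation y ≤ 1 := Iff.rfl

lemma ValuationSubring.le_coarsening (hy : A.valuation y ≤ 1) : A ≤ A.coarsening y hy :=
  fun z hz k => mul_le_one' (pow_le_one' ((A.valuation_le_one_iff z).2 hz) k) hy

lemma ValuationSubring.inv_notMem_coarsening (hy : A.valuation y < 1) (hy0 : y ≠ 0) :
    y⁻¹ ∉ A.coarsening y hy.le := by
  intro h
  -- Exponent 1 would only give the value 1; exponent 2 gives that of `y⁻¹`, which exceeds 1.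
  have h2 := h 2
  have hne : A.valuation y ≠ 0 := by simpa using hy0
  rw [map_inv₀, pow_two, mul_assoc, inv_mul_cancel₀ hne, mul_one,
    inv_le_one₀ (zero_lt_iff.2 hne)] at h2
  exact (h2.trans_lt hy).false

/-- As `x⁻¹` is outside the coarsening, some power of `x` has `A`-value below that of `y`, so the
powers of `x` inherit cofinality; inequalities pass from `A` to the larger ring. -/
lemma ValuationSubring.exists_coarsening_pow_le (hy : A.valuation y < 1)
    (hcof : ∀ z : K, z ≠ 0 → ∃ k : ℕ, A.valuation y ^ k ≤ A.valuation z) {x : K}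
    (hx : (A.coarsening y hy.le).valuation x < 1) {z : K} (hz : z ≠ 0) :
    ∃ k : ℕ, (A.coarsening y hy.le).valuation x ^ k ≤ (A.coarsening y hy.le).valuation z := by
  rcases eq_or_ne x 0 with rfl | hx0
  · exact ⟨1, by simp⟩
  have hxinv : x⁻¹ ∉ A.coarsening y hy.le := by
    rw [← ValuationSubring.valuation_le_one_iff, map_inv₀, inv_le_one₀ (by simpa [zero_lt_iff])]
    exact not_le.2 hx
  rw [ValuationSubring.mem_coarsening] at hxinv
  push Not at hxinv
  obtain ⟨k, hk⟩ := hxinv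
  have hxk : A.valuation x ^ k ≤ A.valuation y := by
    rw [map_inv₀, inv_pow, lt_inv_mul_iff₀ (pow_pos (by simpa [zero_lt_iff]) k), mul_one] at hk
    exact hk.le
  obtain ⟨l, hl⟩ := hcof z hz
  refine ⟨k * l, ?_⟩
  have hv : A.valuation (x ^ (k * l) * z⁻¹) ≤ 1 := by
    rw [map_mul, map_inv₀, mul_inv_le_iff₀ (by simpa [zero_lt_iff]), one_mul, map_pow, pow_mul]
    exact (pow_le_pow_left' hxk l).trans hl
  have hmem := ValuationSubring.le_coarsening hy.le ((A.valuation_le_one_iff _).1 hv)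
  rw [← ValuationSubring.valuation_le_one_iff, map_mul, map_inv₀,
    mul_inv_le_iff₀ (by simpa [zero_lt_iff]), one_mul, map_pow] at hmem
  exact hmem

lemma ValuationSubring.groupHeight_coarsening (hy : A.valuation y < 1) (hy0 : y ≠ 0)
    (hcof : ∀ z : K, z ≠ 0 → ∃ k : ℕ, A.valuation y ^ k ≤ A.valuation z) :
    groupHeight (A.coarsening y hy.le).ValueGroupˣ = 1 := by
  set B := A.coarsening y hy.le with hB
  have hyB : y⁻¹ ∉ B := ValuationSubring.inv_notMem_coarsening hy hy0
  have : Nontrivial B.ValueGroupˣ := by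
    refine ⟨Units.mk0 (B.valuation y) (by simpa), 1, fun h => hyB ?_⟩
    have h1 : B.valuation y = 1 := congrArg Units.val h
    rw [← B.valuation_le_one_iff, map_inv₀, h1, inv_one]
  refine groupHeight_eq_one fun g hg f => ?_
  obtain ⟨x, hx⟩ := B.valuation_surjective g
  obtain ⟨z, hz⟩ := B.valuation_surjective f
  have hz0 : z ≠ 0 := by
    rintro rfl
    rw [map_zero] at hz
    exact f.ne_zero hz.symm
  obtain ⟨k, hk⟩ := ValuationSubring.exists_coarsening_pow_le hy hcof
    (x := x) (by rw [← hB, hx]; exact hg) hz0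
  refine ⟨k, ?_⟩
  rw [← hB, hx, hz] at hk
  exact_mod_cast hk

end Coarsening

/-! ### Infinitely small elements and transcendence degree -/

section TranscendenceDegree

variable {K : Type u} [Field K] {Γ₀ : Type*} [LinearOrderedCommGroupWithZero Γ₀]

/-- The values of the non-zero elements of `S` lie between powers of the value of `y`. -/
def Valuation.BoundedBy (w : Valuation K Γ₀) (S : Set K) (y : K) : Prop :=
  ∀ a ∈ S, a ≠ 0 → ∃ k : ℕ, w y ^ k ≤ w a ∧ w a * w y ^ k ≤ 1

variable {w : Valuation K Γ₀} {y z : K}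

lemma Valuation.BoundedBy.mul_lt {S : Set K} (h : w.BoundedBy S y)
    (hz : ∀ k : ℕ, w z < w y ^ k) {a b : K} (ha : a ∈ S) (ha0 : a ≠ 0) (hb : b ∈ S)
    (hb0 : b ≠ 0) : w z * w b < w a := by
  obtain ⟨k, hk, -⟩ := h a ha ha0
  obtain ⟨l, -, hl⟩ := h b hb hb0
  have hbpos : 0 < w b := by simpa [zero_lt_iff]
  calc w z * w b < w y ^ (k + l) * w b := mul_lt_mul_of_pos_right (hz _) hbpos
    _ = w y ^ k * (w b * w y ^ l) := by rw [pow_add, mul_assoc, mul_comm (w b)]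
    _ ≤ w y ^ k * 1 := mul_le_mul_right hl _
    _ ≤ w a := by rwa [mul_one]

/-- As `z` is infinitely small against the coefficients, the lowest non-zero term dominates; the
induction strips constant terms. -/
lemma Valuation.BoundedBy.map_aeval {F : Type*} [CommRing F] [Algebra F K] {S : Subalgebra F K}
    (h : w.BoundedBy S y) (hz : ∀ k : ℕ, w z < w y ^ k) (p : Polynomial S) (hp : p ≠ 0) :
    ∃ m : ℕ, ∃ c ∈ S, c ≠ 0 ∧ w (Polynomial.aeval z p) = w z ^ m * w c := by
  have hz1 : w z < 1 := by simpa using hz 0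
  induction hd : p.natDegree using Nat.strong_induction_on generalizing p with
  | _ d ih =>
    have hsplit : Polynomial.aeval z p = Polynomial.aeval z p.divX * z + (p.coeff 0 : K) := by
      conv_lhs => rw [← Polynomial.divX_mul_X_add p]
      rw [map_add, map_mul, Polynomial.aeval_X, Polynomial.aeval_C]
      rfl
    have hq (hq0 : p.divX ≠ 0) : ∃ m : ℕ, ∃ c ∈ S, c ≠ 0 ∧
        w (Polynomial.aeval z p.divX) = w z ^ m * w c := by
      have hd0 : p.natDegree ≠ 0 := by
        intro h0
        exact hq0 (by rw [Polynomial.eq_C_of_natDegree_eq_zero h0, Polynomial.divX_C])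
      refine ih _ ?_ _ hq0 rfl
      rw [Polynomial.natDegree_divX_eq_natDegree_tsub_one]
      omega
    by_cases hc : p.coeff 0 = 0
    · have hq0 : p.divX ≠ 0 := by
        intro h0
        apply hp
        rw [← Polynomial.divX_mul_X_add p, h0, hc]
        simp
      obtain ⟨m, c, hcS, hc0, hw⟩ := hq hq0
      refine ⟨m + 1, c, hcS, hc0, ?_⟩
      rw [hsplit, hc]
      simp only [ZeroMemClass.coe_zero, add_zero, map_mul, hw]
      rw [pow_succ]
      ac_rfl
    · have hc' : (p.coeff 0 : K) ≠ 0 := by simpa using hc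
      refine ⟨0, _, (p.coeff 0).2, hc', ?_⟩
      rw [hsplit, pow_zero, one_mul]
      refine w.map_add_eq_of_lt_right ?_
      by_cases hq0 : p.divX = 0
      · simpa [hq0, zero_lt_iff] using hc
      · obtain ⟨m, c, hcS, hc0, hw⟩ := hq hq0
        rw [map_mul, hw, mul_comm]
        refine lt_of_le_of_lt ?_ (h.mul_lt hz (p.coeff 0).2 hc' hcS hc0)
        exact mul_le_mul_right (mul_le_of_le_one_left' (pow_le_one' hz1.le m)) _

lemma Valuation.BoundedBy.transcendental {F : Type*} [CommRing F] [Algebra F K]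
    {S : Subalgebra F K} (h : w.BoundedBy S y) (hz : ∀ k : ℕ, w z < w y ^ k) (hz0 : z ≠ 0) :
    Transcendental S z := by
  rw [transcendental_iff]
  intro p hp
  by_contra hp0
  obtain ⟨m, c, -, hc0, hw⟩ := h.map_aeval hz p hp0
  rw [hp, map_zero, eq_comm, mul_eq_zero] at hw
  rcases hw with hw | hw
  · exact pow_ne_zero m (w.ne_zero_iff.2 hz0) hw
  · exact hc0 (by simpa using hw)

/-- Elements of the larger algebra have value `w z ^ m * w c`, and `w c` lies between powers of `w
y`, all above `w z`; so exponent `m + 1` bounds both sides. -/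
lemma Valuation.BoundedBy.adjoin_insert {F : Type*} [CommRing F] [Algebra F K]
    {s : Set K} (h : w.BoundedBy (Algebra.adjoin F s) y) (hz : ∀ k : ℕ, w z < w y ^ k) :
    w.BoundedBy (Algebra.adjoin F (insert z s)) z := by
  have hz1 : w z < 1 := by simpa using hz 0
  intro e he he0
  rw [← Set.union_singleton, Algebra.adjoin_union_eq_adjoin_adjoin, SetLike.mem_coe,
    Subalgebra.mem_restrictScalars, Algebra.adjoin_singleton_eq_range_aeval] at he
  obtain ⟨p, rfl⟩ := he
  obtain ⟨m, c, hc, hc0, hw⟩ := h.map_aeval hz p (by rintro rfl; exact he0 (map_zero _))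
  refine ⟨m + 1, ?_⟩
  obtain ⟨k, hk, hk'⟩ := h c hc hc0
  change _ ≤ w (Polynomial.aeval z p) ∧ w (Polynomial.aeval z p) * _ ≤ 1
  rw [hw]
  constructor
  · rw [pow_succ]
    exact mul_le_mul_right ((hz k).le.trans hk) _
  · calc w z ^ m * w c * w z ^ (m + 1) = w z ^ m * w z ^ m * (w c * w z) := by
          rw [pow_succ]; ac_rfl
      _ ≤ 1 * (w c * w y ^ k) := by
          refine mul_le_mul' ?_ (mul_le_mul_right (hz k).le _)
          exact mul_le_one' (pow_le_one' hz1.le m) (pow_le_one' hz1.le m)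
      _ ≤ 1 := by rwa [one_mul]

/-- The values on the prime field are bounded. -/
lemma Valuation.exists_boundedBy_bot (hy0 : y ≠ 0) (hy : w y < 1) :
    ∃ x : K, x ≠ 0 ∧ w x < 1 ∧ w.BoundedBy ((⊥ : Subfield K) : Set K) x := by
  have hnat1 (n : ℕ) : w (n : K) ≤ 1 := by
    induction n with
    | zero => simp
    | succ n ih =>
      rw [Nat.cast_succ]
      exact (w.map_add _ _).trans (max_le ih (by simp))
  obtain ⟨x, hx0, hx, hnat⟩ : ∃ x : K, x ≠ 0 ∧ w x < 1 ∧
      ∀ n : ℕ, (n : K) ≠ 0 → ∃ k : ℕ, w x ^ k ≤ w (n : K) := by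
    -- Take the least `p` of value below one and divide by it: a remainder that is non-zero in `K`
    -- has value one by minimality, and otherwise `p` splits off. Without such a `p`, all non-zero
    -- integers have value one and `y` serves.
    by_cases hex : ∃ p : ℕ, (p : K) ≠ 0 ∧ w (p : K) < 1
    · classical
      obtain ⟨hp0, hp⟩ := Nat.find_spec hex
      have hmin (m : ℕ) (hm : m < Nat.find hex) := Nat.find_min hex hm
      set p := Nat.find hex
      refine ⟨p, hp0, hp, fun n => ?_⟩
      induction n using Nat.strong_induction_on with
      | _ n ih =>
        intro hn
        have hppos : 0 < p := Nat.pos_of_ne_zero (by rintro h; simp [h] at hp0)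
        have hp1 : p ≠ 1 := by intro h; simp [h] at hp
        have hdiv : (n : K) = (p : K) * ((n / p : ℕ) : K) + ((n % p : ℕ) : K) := by
          rw [← Nat.cast_mul, ← Nat.cast_add, Nat.div_add_mod]
        by_cases hr : ((n % p : ℕ) : K) = 0
        · rw [hr, add_zero] at hdiv
          have hq : ((n / p : ℕ) : K) ≠ 0 := by
            intro h; rw [hdiv, h, mul_zero] at hn; exact hn rfl
          have hnpos : 0 < n := Nat.pos_of_ne_zero (by rintro rfl; simp at hn)
          obtain ⟨k, hk⟩ := ih _ (Nat.div_lt_self hnpos (by omega)) hq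
          refine ⟨k + 1, ?_⟩
          rw [hdiv, map_mul, pow_succ, mul_comm]
          exact mul_le_mul_right hk _
        · refine ⟨0, ?_⟩
          have hr1 : 1 ≤ w ((n % p : ℕ) : K) := by
            by_contra! hlt
            exact hmin _ (Nat.mod_lt n hppos) ⟨hr, hlt⟩
          rw [pow_zero, hdiv, Valuation.map_add_eq_of_lt_right]
          · exact hr1
          · refine lt_of_lt_of_le ?_ hr1
            rw [map_mul]
            exact mul_lt_one_of_lt_of_le hp (hnat1 _)
    · push Not at hex
      exact ⟨y, hy0, hy, fun n hn => ⟨0, by simpa using hex n hn⟩⟩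
  refine ⟨x, hx0, hx, fun a ha ha0 => ?_⟩
  have hint (n : ℤ) : w (n : K) = w (n.natAbs : K) := by
    rcases n.natAbs_eq with h | h
    · conv_lhs => rw [h]
      simp
    · conv_lhs => rw [h]
      simp
  rw [SetLike.mem_coe, ← Subfield.closure_empty, Subfield.mem_closure_iff, Subring.closure_empty] at ha
  obtain ⟨_, hm, _, hn, rfl⟩ := ha
  obtain ⟨m, rfl⟩ := Subring.mem_bot.1 hm
  obtain ⟨n, rfl⟩ := Subring.mem_bot.1 hn
  rw [div_ne_zero_iff] at ha0
  have hcast {n : ℤ} (hn : (n : K) ≠ 0) : (n.natAbs : K) ≠ 0 := by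
    rw [← w.ne_zero_iff, ← hint, w.ne_zero_iff]; exact hn
  obtain ⟨k, hk⟩ := hnat _ (hcast ha0.1)
  obtain ⟨l, hl⟩ := hnat _ (hcast ha0.2)
  have hnpos : 0 < w (n : K) := by simpa [zero_lt_iff] using ha0.2
  refine ⟨k + l, ?_⟩
  rw [map_div₀, pow_add]
  constructor
  · rw [le_div_iff₀ hnpos, hint, hint]
    calc _ ≤ w x ^ k * 1 * 1 := mul_le_mul' (mul_le_mul_right (pow_le_one' hx.le l) _) (hnat1 _)
      _ ≤ _ := by simpa using hk
  · rw [div_mul_eq_mul_div, div_le_one₀ hnpos, hint, hint]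
    calc _ ≤ (1 : Γ₀) * (1 * w x ^ l) :=
          mul_le_mul' (hnat1 _) (mul_le_mul_left (pow_le_one' hx.le k) _)
      _ ≤ _ := by simpa using hl

/-- A non-trivial valuation on a field of finite transcendence degree over its prime field has
an element whose powers have arbitrarily small values. -/
lemma Valuation.exists_cofinal_powers (hy0 : y ≠ 0) (hy : w y < 1)
    (htr : Algebra.trdeg (⊥ : Subfield K) K < Cardinal.aleph0) :
    ∃ x : K, x ≠ 0 ∧ w x < 1 ∧ ∀ z : K, z ≠ 0 → ∃ k : ℕ, w x ^ k ≤ w z := by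
  by_contra! hno
  -- Each `x` bounding the algebra so far is undercut by a `z` below all its powers, which is
  -- transcendental over that algebra and bounds the next one.
  have key (n : ℕ) : ∃ s : Finset K, s.card = n ∧
      AlgebraicIndepOn (⊥ : Subfield K) id (s : Set K) ∧
      ∃ x : K, x ≠ 0 ∧ w x < 1 ∧
        w.BoundedBy (Algebra.adjoin (⊥ : Subfield K) (s : Set K)) x := by
    classical
    induction n with
    | zero =>
      refine ⟨∅, rfl, ?_, ?_⟩
      · have : IsEmpty ((∅ : Finset K) : Set K) := by simp
        rw [AlgebraicIndepOn, algebraicIndependent_empty_type_iff]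
        exact FaithfulSMul.algebraMap_injective _ _
      · obtain ⟨x, hx0, hx, hb⟩ := Valuation.exists_boundedBy_bot hy0 hy
        refine ⟨x, hx0, hx, fun a ha => hb a ?_⟩
        rw [Finset.coe_empty, Algebra.adjoin_empty, SetLike.mem_coe, Algebra.mem_bot] at ha
        obtain ⟨a, rfl⟩ := ha
        exact a.2
    | succ n ih =>
      obtain ⟨s, hs, hind, x, hx0, hx, hb⟩ := ih
      obtain ⟨z, hz0, hz⟩ := hno x hx0 hx
      have htrans := hb.transcendental hz hz0
      have hzs : z ∉ s := fun hmem => htrans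
        (isAlgebraic_algebraMap (⟨z, Algebra.subset_adjoin hmem⟩ :
          Algebra.adjoin (⊥ : Subfield K) (s : Set K)))
      refine ⟨insert z s, by rw [Finset.card_insert_of_notMem hzs, hs], ?_, z, hz0,
        by simpa using hz 0, ?_⟩
      · rw [Finset.coe_insert]
        exact hind.insert (by rw [Set.image_id]; exact htrans)
      · rw [Finset.coe_insert]
        exact hb.adjoin_insert hz
  obtain ⟨d, hd⟩ := Cardinal.lt_aleph0.1 htr
  obtain ⟨s, hs, hind, -⟩ := key (d + 1)
  have hle := AlgebraicIndependent.cardinalMk_le_trdeg hind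
  rw [hd] at hle
  have : Cardinal.mk (s : Set K) = (d + 1 : ℕ) := by simp [hs]
  rw [this, Nat.cast_le] at hle
  omega

end TranscendenceDegree

/-! ### Assembly of the valuation -/

theorem mainTheorem6 {K : Type u} [Field K] (N : Subgroup Kˣ) [N.FiniteIndex]
    (hN : (-1 : Kˣ) ∈ N)
    {Γ : Type v} [AddGroup Γ] [LinearOrder Γ] [AddLeftMono Γ] [AddRightMono Γ]
    (φ : Additive N →+ Γ) (hφ : IsStrongValuationLike φ) :
    ∃ (Γ₀ : Type u) (_ : LinearOrderedCommGroupWithZero Γ₀) (w : Valuation K Γ₀),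
      Function.Surjective w ∧
      w.IsNontrivial ∧
      IsAssociated φ w ∧
      IsOpen[adicTopologyUnits w] (N : Set Kˣ) ∧
      (Algebra.trdeg (⊥ : Subfield K) K < Cardinal.aleph0 → groupHeight Γ₀ˣ = 1) ∧
      IsOpen[adicTopology w] (nonnegSubring φ : Set K) := by
  obtain ⟨α, hα⟩ := hφ
  have hassoc (B : ValuationSubring K) (hB : integralValuationSubring φ ≤ B) :
      IsAssociated φ B.valuation := fun x hx =>
    (B.valuation_le_one_iff _).2
      (hB (nonnegSubring_le_integralValuationSubring (coe_mem_nonnegSubring hx)))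
  -- Association and both openness claims hold for every overring; only properness and height depend
  -- on the choice of `B`.
  suffices ∃ B : ValuationSubring K, integralValuationSubring φ ≤ B ∧ (∃ x, x ∉ B) ∧
      (Algebra.trdeg (⊥ : Subfield K) K < Cardinal.aleph0 →
        groupHeight B.ValueGroupˣ = 1) by
    obtain ⟨B, hB, ⟨x, hx⟩, hheight⟩ := this
    refine ⟨B.ValueGroup, inferInstance, B.valuation, B.valuation_surjective, ⟨x, ?_, ?_⟩,
      hassoc B hB, (hassoc B hB).isOpen_subgroup hN hα, hheight,
      (hassoc B hB).isOpen_nonnegSubring hα⟩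
    · rw [Valuation.ne_zero_iff]
      rintro rfl
      exact hx (zero_mem _)
    · intro h
      exact hx ((B.valuation_le_one_iff x).1 h.le)
  obtain ⟨x, hx⟩ := hα.exists_notMem_integralValuationSubring hN
  -- Coarsening is needed only for the height; in infinite transcendence degree the integral closure
  -- itself serves.
  by_cases htr : Algebra.trdeg (⊥ : Subfield K) K < Cardinal.aleph0
  · have hx0 : x ≠ 0 := by rintro rfl; exact hx (zero_mem _)
    have hxlt : (integralValuationSubring φ).valuation x⁻¹ < 1 := by
      rw [← ValuationSubring.valuation_le_one_iff, not_le] at hx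
      rw [map_inv₀]
      exact inv_lt_one_of_one_lt₀ hx
    obtain ⟨y, hy0, hy, hcof⟩ := Valuation.exists_cofinal_powers (inv_ne_zero hx0) hxlt htr
    exact ⟨_, ValuationSubring.le_coarsening hy.le,
      ⟨_, ValuationSubring.inv_notMem_coarsening hy hy0⟩,
      fun _ => ValuationSubring.groupHeight_coarsening hy hy0 hcof⟩
  · exact ⟨_, le_rfl, ⟨x, hx⟩, fun h => absurd h htr⟩
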